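/- Let $K$ be a field, $n\ge 3$, and let $X=(x_{ij})$, $Y=(y_{ij})$ be $n\times n$ matrices of indeterminates. Let $R=K[x_{ij},y_{ij} : 1\le i,j\le n]$ with its standard grading, and let $I\subseteq R$ be the ideal generated by the diagonal entries of the commutator matrix $XY-YX$. Then the images in $R/I$ of the elements $$x_{11};\qquad x_{ij}\ (2\le i\le n,\ 1\le j\le n);\qquad y_{ij}\ (1\le i\le n,\ 2\le j\le n);\qquad x_{1j}-y_{j1}\ (1\le j\le n)$$ form a homogeneous system of parameters of $R/I$ (they are homogeneous of positive degree, their number, $2n^2-n+1$, equals the Krull dimension of $R/I$, and the quotient of $R/I$ by the ideal they generate has Krull dimension $0$), and, in any order, they form a regular sequence on $R/I$. Moreover, the quotient of $R/I$ by the ideal generated by these elements is isomorphic as a $K$-algebra to $$K[x_{12},\dots,x_{1n}]/(x_{12}^2,\dots,x_{1n}^2),$$ by an isomorphism that sends the class of $x_{1j}$ to the class of $x_{1j}$ for $2\le j\le n$. -/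

import Mathlib

noncomputable section

namespace CommDiag

open MvPolynomial

/-- The variables `x_{ij}` (left summand) and `y_{ij}` (right summand); indices run over `Fin n`, so
the index `0` plays the role of the usual index `1`. -/
abbrev Vars (n : ℕ) : Type := (Fin n × Fin n) ⊕ (Fin n × Fin n)

/-- The polynomial ring `R = K[X, Y]` in the entries of two `n × n` matrices. -/
abbrev PolyRing (n : ℕ) (K : Type*) [Field K] : Type _ := MvPolynomial (Vars n) K

/-- The generic matrix `X = (x_{ij})`. -/
def matX (n : ℕ) (K : Type*) [Field K] : Matrix (Fin n) (Fin n) (PolyRing n K) :=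
  Matrix.of fun i j => X (Sum.inl (i, j))

/-- The generic matrix `Y = (y_{ij})`. -/
def matY (n : ℕ) (K : Type*) [Field K] : Matrix (Fin n) (Fin n) (PolyRing n K) :=
  Matrix.of fun i j => X (Sum.inr (i, j))

/-- The commutator matrix `C = XY - YX`. -/
def commutator (n : ℕ) (K : Type*) [Field K] : Matrix (Fin n) (Fin n) (PolyRing n K) :=
  matX n K * matY n K - matY n K * matX n K

/-- The ideal `I` generated by the diagonal entries of the commutator matrix. -/
def diagIdeal (n : ℕ) (K : Type*) [Field K] : Ideal (PolyRing n K) :=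
  Ideal.span (Set.range fun i : Fin n => commutator n K i i)

/-- The coordinate ring `R/I`. -/
abbrev CoordRing (n : ℕ) (K : Type*) [Field K] : Type _ := PolyRing n K ⧸ diagIdeal n K

/-- The generators of `I` are forms of degree two, so `R/I` inherits the standard grading. -/
theorem commutator_diag_isHomogeneous (n : ℕ) (K : Type*) [Field K] (i : Fin n) :
    (commutator n K i i).IsHomogeneous 2 := by
  simp only [commutator, Matrix.sub_apply, Matrix.mul_apply, matX, matY, Matrix.of_apply]
  exact (IsHomogeneous.sum _ _ _ fun j _ => (isHomogeneous_X K _).mul (isHomogeneous_X K _)).sub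
    (IsHomogeneous.sum _ _ _ fun j _ => (isHomogeneous_X K _).mul (isHomogeneous_X K _))

/-- The grading of `R/I` induced by the standard grading of `R`: its piece of degree `d` is the
image of the forms of degree `d`. -/
def grading (n : ℕ) (K : Type*) [Field K] (d : ℕ) : Submodule K (CoordRing n K) :=
  (homogeneousSubmodule (Vars n) K d).map (Ideal.Quotient.mkₐ K (diagIdeal n K)).toLinearMap

/-- For a `K`-algebra `A` graded by `𝒜` (in degrees `ℕ`, with `𝒜 0 = K`), a finite family `f` of
elements of `A` is a homogeneous system of parameters if its members are homogeneous of positive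
degree, their number is the Krull dimension of `A`, and `A/(f)` has Krull dimension zero. -/
structure IsHomogeneousSOP {K A : Type*} [Field K] [CommRing A] [Algebra K A]
    (𝒜 : ℕ → Submodule K A) {ι : Type*} [Fintype ι] (f : ι → A) : Prop where
  homogeneous : ∀ i, ∃ d, 0 < d ∧ f i ∈ 𝒜 d
  card_eq_dim : ringKrullDim A = (Fintype.card ι : WithBot ℕ∞)
  quotient_dim : ringKrullDim (A ⧸ Ideal.span (Set.range f)) = 0

/-- A finite family is a regular sequence on `A` in whichever order its members are listed. -/
def IsRegularFamily (A : Type*) [CommRing A] {ι : Type*} (f : ι → A) : Prop :=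
  ∀ l : List ι, l.Nodup → (∀ i, i ∈ l) → RingTheory.Sequence.IsRegular A (l.map f)

/-- Index set of the system of parameters: one index for `x_{11}`, the positions `(i, j)` with
`i ≥ 2`, the positions `(i, j)` with `j ≥ 2`, and the indices `1 ≤ j ≤ n`. -/
abbrev ParamIndex (n : ℕ) [NeZero n] : Type :=
  Unit ⊕ {p : Fin n × Fin n // p.1 ≠ 0} ⊕ {p : Fin n × Fin n // p.2 ≠ 0} ⊕ Fin n

/-- The elements `x_{11}`; `x_{ij}` with `i ≥ 2`; `y_{ij}` with `j ≥ 2`; `x_{1j} - y_{j1}`. -/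
def param (n : ℕ) [NeZero n] (K : Type*) [Field K] : ParamIndex n → PolyRing n K
  | Sum.inl _ => matX n K 0 0
  | Sum.inr (Sum.inl p) => matX n K p.1.1 p.1.2
  | Sum.inr (Sum.inr (Sum.inl p)) => matY n K p.1.1 p.1.2
  | Sum.inr (Sum.inr (Sum.inr j)) => matX n K 0 j - matY n K j 0

/-- The images of these elements in `R/I`. -/
def paramBar (n : ℕ) [NeZero n] (K : Type*) [Field K] (s : ParamIndex n) : CoordRing n K :=
  Ideal.Quotient.mk (diagIdeal n K) (param n K s)

/-- The quotient of `R/I` by the ideal generated by these elements. -/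
abbrev ParamQuotient (n : ℕ) [NeZero n] (K : Type*) [Field K] : Type _ :=
  CoordRing n K ⧸ Ideal.span (Set.range (paramBar n K))

/-- The ring `K[x_{12}, …, x_{1n}]/(x_{12}², …, x_{1n}²)`. -/
abbrev SquareZeroRing (n : ℕ) [NeZero n] (K : Type*) [Field K] : Type _ :=
  MvPolynomial {j : Fin n // j ≠ 0} K ⧸
    Ideal.span (Set.range fun j : {j : Fin n // j ≠ 0} =>
      (X j ^ 2 : MvPolynomial {j : Fin n // j ≠ 0} K))

end CommDiag

end

/-!
Let `P` be the polynomial ring over `K` in the parameters.  Adjoining the entries `t_j = x_{1j}`,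
`j ≥ 2`, to the parameters gives new coordinates on `R`, since `y_{j1} = t_j - (x_{1j} - y_{j1})`.
In these coordinates the `j`-th diagonal entry of `XY - YX` is, for `j ≥ 2`, up to sign a monic
quadratic polynomial in `t_j` alone over `P`, and the first diagonal entry is redundant because a
commutator has trace zero.  Hence `R/I` arises from `P` by adjoining one root of each of `n - 1`
monic quadratic polynomials.  It is finite and free over `P`, so it has the dimension of `P` and
the variables of `P` remain a regular sequence, in any order; setting them to zero turns the
quadratic polynomials into the squares `t_j ^ 2`.
-/

section KrullDimension

variable (A B : Type*) [CommRing A] [CommRing B] [Algebra A B]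

theorem ringKrullDim_le_of_isIntegral [Algebra.IsIntegral A B] :
    ringKrullDim B ≤ ringKrullDim A :=
  Order.krullDim_le_of_strictMono (PrimeSpectrum.comap (algebraMap A B))
    fun _ _ h => Ideal.IsIntegral.comap_lt_comap (R := A) h

theorem ringKrullDim_le_of_faithfullyFlat [Module.FaithfullyFlat A B] :
    ringKrullDim A ≤ ringKrullDim B := by
  refine iSup_le fun l => ?_
  obtain ⟨Q, hQ⟩ := PrimeSpectrum.comap_surjective_of_faithfullyFlat (B := B) (RelSeries.last l)
  have : Q.asIdeal.LiesOver (RelSeries.last l).asIdeal := ⟨by rw [← hQ]; rfl⟩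
  obtain ⟨L, hL, -⟩ := Ideal.exists_ltSeries_of_hasGoingDown l Q.asIdeal
  exact hL ▸ Order.LTSeries.length_le_krullDim L

end KrullDimension

section Variables

open MvPolynomial

variable {σ R : Type*} [CommRing R]

theorem mem_span_X_image_of_X_mul_mem {s : Set σ} {a : σ} (ha : a ∉ s) {f : MvPolynomial σ R}
    (h : X a * f ∈ Ideal.span (X '' s : Set (MvPolynomial σ R))) :
    f ∈ Ideal.span (X '' s : Set (MvPolynomial σ R)) := by
  rw [mem_ideal_span_X_image] at h ⊢
  intro m hm
  obtain ⟨i, hi, hne⟩ := h (Finsupp.single a 1 + m)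
    (by rwa [mem_support_iff, coeff_X_mul, ← mem_support_iff])
  have hai : a ≠ i := fun hai => ha (hai ▸ hi)
  exact ⟨i, hi, by simpa [Finsupp.single_apply, hai] using hne⟩

theorem span_X_image_ne_top [Nontrivial R] (s : Set σ) :
    Ideal.span (X '' s : Set (MvPolynomial σ R)) ≠ ⊤ := by
  rw [Ideal.ne_top_iff_one, mem_ideal_span_X_image]
  intro h
  obtain ⟨_, -, hi⟩ := h 0 (by simp)
  exact hi rfl

theorem ofList_map_X_smul_top (l : List σ) :
    (Ideal.ofList (l.map (X : σ → MvPolynomial σ R)) • ⊤ : Ideal (MvPolynomial σ R)) =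
      Ideal.span (X '' {i | i ∈ l}) := by
  rw [smul_eq_mul, Ideal.mul_top, Ideal.ofList]
  congr 1
  ext
  simp

theorem isRegular_map_X [Nontrivial R] {l : List σ} (hl : l.Nodup) :
    RingTheory.Sequence.IsRegular (MvPolynomial σ R) (l.map (X : σ → MvPolynomial σ R)) where
  regular_mod_prev k hk := by
    have hlk : l[k]'(by simpa using hk) ∉ {i | i ∈ l.take k} := fun hmem => by
      obtain ⟨j, hj, hjk⟩ := List.mem_take_iff_getElem.mp hmem
      have := hl.getElem_inj_iff.mp hjk
      lia
    rw [← List.map_take, ofList_map_X_smul_top, isSMulRegular_iff_right_eq_zero_of_smul]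
    intro x hx
    obtain ⟨f, rfl⟩ := Submodule.Quotient.mk_surjective _ x
    rw [← Submodule.Quotient.mk_smul, Submodule.Quotient.mk_eq_zero, smul_eq_mul,
      List.getElem_map] at hx
    exact (Submodule.Quotient.mk_eq_zero _).mpr (mem_span_X_image_of_X_mul_mem hlk hx)
  top_ne_smul := by
    rw [ofList_map_X_smul_top]
    exact (span_X_image_ne_top _).symm

end Variables

/-- The `A`-algebra obtained by adjoining to `A`, independently for each index `i`, a root of the
univariate polynomial `p i`: the analogue of `AdjoinRoot` for a family of polynomials. -/
def AdjoinRoots {ι A : Type*} [CommRing A] (p : ι → Polynomial A) : Type _ :=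
  MvPolynomial ι A ⧸
    Ideal.span (Set.range fun i => Polynomial.aeval (MvPolynomial.X i : MvPolynomial ι A) (p i))

namespace AdjoinRoots

open Polynomial

variable {R ι κ A B : Type*} [CommRing R] [CommRing A] [CommRing B] [Algebra R A] [Algebra R B]

noncomputable instance (p : ι → A[X]) : CommRing (AdjoinRoots p) :=
  inferInstanceAs (CommRing (MvPolynomial ι A ⧸ _))

noncomputable instance (p : ι → A[X]) : Algebra R (AdjoinRoots p) :=
  inferInstanceAs (Algebra R (MvPolynomial ι A ⧸ _))

instance (p : ι → A[X]) : IsScalarTower R A (AdjoinRoots p) :=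
  inferInstanceAs (IsScalarTower R A (MvPolynomial ι A ⧸ _))

/-- The adjoined root of `p i`. -/
noncomputable def root (p : ι → A[X]) (i : ι) : AdjoinRoots p :=
  Ideal.Quotient.mk _ (MvPolynomial.X i)

theorem eval₂_root (p : ι → A[X]) (i : ι) :
    (p i).eval₂ (Algebra.ofId A (AdjoinRoots p)) (root p i) = 0 :=
  let mk : MvPolynomial ι A →ₐ[A] AdjoinRoots p := Ideal.Quotient.mkₐ A _
  (aeval_algHom_apply mk (MvPolynomial.X i) (p i)).trans <|
    Ideal.Quotient.eq_zero_iff_mem.mpr (Ideal.subset_span ⟨i, rfl⟩)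

/-- The homomorphism out of `AdjoinRoots p` determined by its restriction `φ` to the coefficients
and the images `b i` of the adjoined roots. -/
noncomputable def liftAlgHom {p : ι → A[X]} (φ : A →ₐ[R] B) (b : ι → B)
    (h : ∀ i, (p i).eval₂ φ (b i) = 0) : AdjoinRoots p →ₐ[R] B :=
  Ideal.Quotient.liftₐ _ (MvPolynomial.aevalTower φ b) <| by
    suffices Ideal.span (Set.range fun i => aeval (MvPolynomial.X i) (p i)) ≤
        RingHom.ker (MvPolynomial.aevalTower φ b) from fun _ ha => this ha
    rw [Ideal.span_le]
    rintro _ ⟨i, rfl⟩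
    rw [SetLike.mem_coe, RingHom.mem_ker, ← h i, ← AlgHom.coe_toRingHom]
    simp [aeval_def, hom_eval₂]

section lift

variable {p : ι → A[X]} (φ : A →ₐ[R] B) (b : ι → B) (h : ∀ i, (p i).eval₂ φ (b i) = 0)

@[simp]
theorem liftAlgHom_root (i : ι) : liftAlgHom φ b h (root p i) = b i :=
  (Ideal.Quotient.lift_mk _ _ _).trans (MvPolynomial.aevalTower_X φ b i)

@[simp]
theorem liftAlgHom_algebraMap (a : A) :
    liftAlgHom φ b h (algebraMap A (AdjoinRoots p) a) = φ a :=
  (Ideal.Quotient.lift_mk _ _ _).trans (MvPolynomial.aevalTower_C φ b a)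

end lift

theorem algHom_ext {p : ι → A[X]} {f g : AdjoinRoots p →ₐ[R] B}
    (hA : ∀ a, f (algebraMap A _ a) = g (algebraMap A _ a))
    (hroot : ∀ i, f (root p i) = g (root p i)) : f = g := by
  refine Ideal.Quotient.algHom_ext _ (AlgHom.coe_ringHom_injective ?_)
  exact MvPolynomial.ringHom_ext hA hroot

/-- Reindexing the family of adjoined roots. -/
noncomputable def reindex (e : ι ≃ κ) (p : κ → A[X]) : AdjoinRoots (p ∘ e) ≃ₐ[A] AdjoinRoots p :=
  AlgEquiv.ofAlgHom
    (liftAlgHom (Algebra.ofId A _) (fun i => root p (e i)) fun i => eval₂_root p (e i))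
    (liftAlgHom (Algebra.ofId A _) (fun k => root (p ∘ e) (e.symm k)) fun k => by
      simpa using! eval₂_root (p ∘ e) (e.symm k))
    (algHom_ext (by simp) (by simp)) (algHom_ext (by simp) (by simp))

/-- Adjoining a family of roots indexed by `Option ι` amounts to adjoining the roots indexed by `ι`
and then one more. -/
noncomputable def optionEquiv (p : Option ι → A[X]) :
    AdjoinRoots p ≃ₐ[A]
      AdjoinRoot ((p none).map (algebraMap A (AdjoinRoots fun i => p (some i)))) :=
  AlgEquiv.ofAlgHom
    (liftAlgHom (Algebra.ofId A _)
      (fun o => o.elim (AdjoinRoot.root _) fun i => AdjoinRoot.of _ (root _ i)) <| by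
        rintro (_ | i)
        · exact (eval₂_map ..).symm.trans (AdjoinRoot.eval₂_root _)
        · exact (hom_eval₂ ..).symm.trans <|
            (congrArg (AdjoinRoot.of _) (eval₂_root (fun i => p (some i)) i)).trans (map_zero _))
    (AdjoinRoot.liftAlgHom _
      (liftAlgHom (Algebra.ofId A _) (fun i => root p (some i)) fun i => eval₂_root p (some i))
      (root p none) <| by
        rw [eval₂_map, ← eval₂_root p none]
        exact congrArg (fun f => eval₂ f _ _) (AlgHom.comp_algebraMap _))
    (AdjoinRoot.algHom_ext' (algHom_ext (by simp) (by simp)) (by simp))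
    (algHom_ext (by simp) fun o => by cases o <;> simp)

theorem free_and_finite [Finite ι] {p : ι → A[X]} (hp : ∀ i, (p i).Monic) :
    Module.Free A (AdjoinRoots p) ∧ Module.Finite A (AdjoinRoots p) := by
  induction ι using Finite.induction_empty_option with
  | of_equiv e ih =>
    obtain ⟨_, _⟩ := ih (p := p ∘ e) fun i => hp (e i)
    exact ⟨.of_equiv (reindex e p).toLinearEquiv, .equiv (reindex e p).toLinearEquiv⟩
  | h_empty =>
    let e : A ≃ₐ[A] AdjoinRoots p :=
      AlgEquiv.ofAlgHom (Algebra.ofId A _) (liftAlgHom (.id A A) isEmptyElim isEmptyElim)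
        (algHom_ext (by simp) isEmptyElim) (by ext)
    exact ⟨.of_equiv e.toLinearEquiv, .equiv e.toLinearEquiv⟩
  | h_option ih =>
    obtain ⟨_, _⟩ := ih (p := fun i => p (some i)) fun i => hp (some i)
    let B := AdjoinRoots fun i => p (some i)
    let C := AdjoinRoot ((p none).map (algebraMap A B))
    have monic_map := (hp none).map (algebraMap A B)
    have : Module.Free B C := monic_map.free_adjoinRoot
    have : Module.Finite B C := monic_map.finite_adjoinRoot
    have : Module.Free A C := .trans (S := B)
    have : Module.Finite A C := .trans B C
    exact ⟨.of_equiv (optionEquiv p).symm.toLinearEquiv,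
      .equiv (optionEquiv p).symm.toLinearEquiv⟩

theorem nontrivial [Nontrivial A] {p : ι → A[X]} (hp : ∀ i, (p i).Monic)
    (hdeg : ∀ i, (p i).natDegree ≠ 0) : Nontrivial (AdjoinRoots p) := by
  obtain ⟨m, hm⟩ := Ideal.exists_maximal A
  let := Ideal.Quotient.field m
  let k := AlgebraicClosure (A ⧸ m)
  have exists_root (i : ι) : ∃ b : k, (p i).eval₂ (Algebra.ofId A k) b = 0 := by
    have hdeg_map : ((p i).map (algebraMap A k)).degree ≠ 0 := by
      rw [(hp i).degree_map]
      exact fun h => hdeg i (natDegree_eq_of_degree_eq_some h)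
    obtain ⟨b, hb⟩ := IsAlgClosed.exists_root _ hdeg_map
    exact ⟨b, by rwa [IsRoot, eval_map] at hb⟩
  choose b hb using exists_root
  exact (liftAlgHom (Algebra.ofId A k) b hb).toRingHom.domain_nontrivial

section Monic

variable [Finite ι] [Nontrivial A] {p : ι → A[X]}

theorem faithfullyFlat (hp : ∀ i, (p i).Monic) (hdeg : ∀ i, (p i).natDegree ≠ 0) :
    Module.FaithfullyFlat A (AdjoinRoots p) := by
  have := (free_and_finite hp).1
  have := nontrivial hp hdeg
  infer_instance

theorem ringKrullDim_eq (hp : ∀ i, (p i).Monic) (hdeg : ∀ i, (p i).natDegree ≠ 0) :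
    ringKrullDim (AdjoinRoots p) = ringKrullDim A := by
  have := (free_and_finite hp).2
  have := faithfullyFlat hp hdeg
  exact le_antisymm (ringKrullDim_le_of_isIntegral A _) (ringKrullDim_le_of_faithfullyFlat A _)

end Monic

end AdjoinRoots

theorem commutator_diag_eq_zero_of_ne {m S : Type*} [Fintype m] [CommRing S]
    {A B : Matrix m m S} {i₀ : m} (h : ∀ i ≠ i₀, (A * B - B * A) i i = 0) :
    (A * B - B * A) i₀ i₀ = 0 :=
  calc (A * B - B * A) i₀ i₀ = (A * B - B * A).trace := (Fintype.sum_eq_single i₀ h).symm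
    _ = 0 := by rw [Matrix.trace_sub, Matrix.trace_mul_comm, sub_self]

noncomputable section

namespace CommDiag

variable {n : ℕ} [NeZero n]

/-- The indices `j ≥ 2` of the entries `t_j = x_{1j}` which complete the parameters to a coordinate
system of the space of pairs of matrices. -/
abbrev RowIndex (n : ℕ) [NeZero n] : Type := {j : Fin n // j ≠ 0}

/-- The index of the parameter `x_{1j} - y_{j1}`. -/
abbrev diffIndex (j : Fin n) : ParamIndex n := Sum.inr (Sum.inr (Sum.inr j))

section Coordinates

variable {S T : Type*}

/-- The matrix `X` over `S` for which the parameters take the values `f` and the remaining entries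
of the first row are `t`. -/
def xMatrix (f : ParamIndex n → S) (t : RowIndex n → S) : Matrix (Fin n) (Fin n) S :=
  Matrix.of fun i j =>
    if hi : i = 0 then
      if hj : j = 0 then f (Sum.inl ()) else t ⟨j, hj⟩
    else f (Sum.inr (Sum.inl ⟨(i, j), hi⟩))

variable (f : ParamIndex n → S) (t : RowIndex n → S)

theorem xMatrix_zero_row (j : RowIndex n) : xMatrix f t 0 j = t j := by
  simp [xMatrix, j.2]

theorem xMatrix_of_row_ne_zero {i : Fin n} (hi : i ≠ 0) (j : Fin n) :
    xMatrix f t i j = f (Sum.inr (Sum.inl ⟨(i, j), hi⟩)) := by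
  simp [xMatrix, hi]

variable [CommRing S] [CommRing T]

/-- The matrix `Y` over `S` for which the parameters take the values `f`, given that the remaining
entries of the first row of `X` are `t`. -/
def yMatrix : Matrix (Fin n) (Fin n) S :=
  Matrix.of fun i j =>
    if hj : j = 0 then xMatrix f t 0 i - f (diffIndex i)
    else f (Sum.inr (Sum.inr (Sum.inl ⟨(i, j), hj⟩)))

/-- The diagonal entries of `XY - YX` in the coordinates `f` and `t`. -/
def diagEntry (i : Fin n) : S :=
  (xMatrix f t * yMatrix f t - yMatrix f t * xMatrix f t) i i

theorem yMatrix_zero_col (i : Fin n) :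
    yMatrix f t i 0 = xMatrix f t 0 i - f (diffIndex i) := by
  simp [yMatrix]

theorem yMatrix_of_col_ne_zero (i : Fin n) {j : Fin n} (hj : j ≠ 0) :
    yMatrix f t i j = f (Sum.inr (Sum.inr (Sum.inl ⟨(i, j), hj⟩))) := by
  simp [yMatrix, hj]

theorem diagEntry_eq_sub (j : RowIndex n) :
    diagEntry f t j = diagEntry f 0 j - (t j - f (diffIndex j)) * t j := by
  have hXY : (xMatrix f t * yMatrix f t) j j = (xMatrix f 0 * yMatrix f 0) j j := by
    simp only [Matrix.mul_apply, xMatrix_of_row_ne_zero _ _ j.2, yMatrix_of_col_ne_zero _ _ _ j.2]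
  have hYX : (yMatrix f t * xMatrix f t) j j - (yMatrix f 0 * xMatrix f 0) j j =
      (t j - f (diffIndex j)) * t j := by
    rw [Matrix.mul_apply, Matrix.mul_apply, ← Finset.sum_sub_distrib, Fintype.sum_eq_single 0]
    · simp only [yMatrix_zero_col, xMatrix_zero_row, Pi.zero_apply, mul_zero, sub_zero]
    · intro k hk
      simp only [xMatrix_of_row_ne_zero _ _ hk, yMatrix_of_col_ne_zero _ _ _ hk, sub_self]
  rw [diagEntry, diagEntry, Matrix.sub_apply, Matrix.sub_apply, hXY, ← hYX]
  ring

theorem diagEntry_zero (i : Fin n) : diagEntry (0 : ParamIndex n → S) 0 i = 0 := by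
  have xMatrix_zero : xMatrix (0 : ParamIndex n → S) 0 = 0 := by ext; simp [xMatrix]
  simp [diagEntry, xMatrix_zero]

theorem map_xMatrix (φ : S →+* T) : (xMatrix f t).map φ = xMatrix (φ ∘ f) (φ ∘ t) := by
  ext i j
  simp only [xMatrix, Matrix.map_apply, Matrix.of_apply, Function.comp_apply, apply_dite φ]

theorem map_yMatrix (φ : S →+* T) : (yMatrix f t).map φ = yMatrix (φ ∘ f) (φ ∘ t) := by
  ext i j
  simp only [yMatrix, ← map_xMatrix, Matrix.map_apply, Matrix.of_apply, Function.comp_apply,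
    apply_dite φ, map_sub]

theorem map_diagEntry (φ : S →+* T) (i : Fin n) :
    φ (diagEntry f t i) = diagEntry (φ ∘ f) (φ ∘ t) i := by
  simp only [diagEntry, ← map_xMatrix, ← map_yMatrix, ← Matrix.map_mul, Matrix.sub_apply,
    Matrix.map_apply, map_sub]

section rowPoly

open Polynomial

/-- The monic quadratic polynomial over `S` satisfied by `t_j` when the diagonal of `XY - YX`
vanishes and the parameters take the values `f`. -/
def rowPoly (j : RowIndex n) : S[X] :=
  X ^ 2 - C (f (diffIndex j)) * X - C (diagEntry f 0 j)

theorem rowPoly_zero (j : RowIndex n) : rowPoly (0 : ParamIndex n → S) j = X ^ 2 := by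
  simp [rowPoly, diagEntry_zero]

theorem monic_rowPoly (j : RowIndex n) : (rowPoly f j).Monic := by
  unfold rowPoly
  monicity!

theorem natDegree_rowPoly_ne_zero [Nontrivial S] (j : RowIndex n) :
    (rowPoly f j).natDegree ≠ 0 := by
  have : (rowPoly f j).natDegree = 2 := by
    unfold rowPoly
    compute_degree!
  lia

theorem eval₂_rowPoly (φ : S →+* T) (t : RowIndex n → T) (j : RowIndex n) :
    (rowPoly f j).eval₂ φ (t j) = -diagEntry (φ ∘ f) t j := by
  have map_const : φ (diagEntry f 0 j) = diagEntry (φ ∘ f) 0 j := by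
    rw [map_diagEntry]
    congr 1
    ext
    simp
  rw [diagEntry_eq_sub, ← map_const]
  simp only [rowPoly, eval₂_sub, eval₂_mul, eval₂_pow, eval₂_X, eval₂_C, Function.comp_apply]
  ring

end rowPoly

end Coordinates

section CoordRing

variable {K : Type*} [Field K] {S T : Type*} [CommRing S] [CommRing T] [Algebra K S] [Algebra K T]

variable (n K) in
/-- The images `t_j` in `R/I` of the entries `x_{1j}`, `j ≥ 2`. -/
def rowBar (j : RowIndex n) : CoordRing n K :=
  Ideal.Quotient.mk (diagIdeal n K) (matX n K 0 j)

theorem map_mk_matX :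
    (matX n K).map (Ideal.Quotient.mk (diagIdeal n K)) =
      xMatrix (paramBar n K) (rowBar n K) := by
  ext i j
  rcases eq_or_ne i 0 with rfl | hi
  · rcases eq_or_ne j 0 with rfl | hj
    · simp [xMatrix, paramBar, param]
    · exact (xMatrix_zero_row (paramBar n K) (rowBar n K) ⟨j, hj⟩).symm
  · exact (xMatrix_of_row_ne_zero (paramBar n K) _ hi j).symm

theorem map_mk_matY :
    (matY n K).map (Ideal.Quotient.mk (diagIdeal n K)) =
      yMatrix (paramBar n K) (rowBar n K) := by
  ext i j
  rcases eq_or_ne j 0 with rfl | hj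
  · rw [yMatrix_zero_col, ← map_mk_matX]
    simp [paramBar, param]
  · exact (yMatrix_of_col_ne_zero (paramBar n K) _ i hj).symm

theorem diagEntry_bar (i : Fin n) : diagEntry (paramBar n K) (rowBar n K) i = 0 := by
  rw [diagEntry, ← map_mk_matX, ← map_mk_matY, ← Matrix.map_mul, ← Matrix.map_mul,
    ← Matrix.map_sub _ (map_sub _)]
  exact Ideal.Quotient.eq_zero_iff_mem.mpr (Ideal.subset_span ⟨i, rfl⟩)

section lift

variable (f : ParamIndex n → S) (t : RowIndex n → S)

variable (K) in
/-- The homomorphism out of `R` determined by the images `f` of the parameters and `t` of the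
remaining entries of the first row of `X`. -/
def polyRingLift : PolyRing n K →ₐ[K] S :=
  MvPolynomial.aeval <|
    Sum.elim (fun p => xMatrix f t p.1 p.2) (fun p => yMatrix f t p.1 p.2)

theorem map_polyRingLift_matX : (matX n K).map (polyRingLift K f t) = xMatrix f t := by
  ext
  simp [polyRingLift, matX]

theorem map_polyRingLift_matY : (matY n K).map (polyRingLift K f t) = yMatrix f t := by
  ext
  simp [polyRingLift, matY]

theorem polyRingLift_param (s : ParamIndex n) : polyRingLift K f t (param n K s) = f s := by
  have hX (i j) : polyRingLift K f t (matX n K i j) = xMatrix f t i j :=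
    congrFun₂ (map_polyRingLift_matX f t) i j
  have hY (i j) : polyRingLift K f t (matY n K i j) = yMatrix f t i j :=
    congrFun₂ (map_polyRingLift_matY f t) i j
  rcases s with _ | ⟨⟨i, j⟩, hi⟩ | ⟨⟨i, j⟩, hj⟩ | j
  · simp [param, hX, xMatrix]
  · exact (hX i j).trans (xMatrix_of_row_ne_zero f t hi j)
  · exact (hY i j).trans (yMatrix_of_col_ne_zero f t i hj)
  · simp [param, hX, hY, yMatrix_zero_col]

variable {f t} in
theorem diagIdeal_le_ker_polyRingLift (h : ∀ j : RowIndex n, diagEntry f t j = 0) :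
    diagIdeal n K ≤ RingHom.ker (polyRingLift K f t) := by
  have map_commutator : (commutator n K).map (polyRingLift K f t) =
      xMatrix f t * yMatrix f t - yMatrix f t * xMatrix f t := by
    rw [commutator, Matrix.map_sub _ (map_sub _), Matrix.map_mul, Matrix.map_mul,
      map_polyRingLift_matX, map_polyRingLift_matY]
  rw [diagIdeal, Ideal.span_le]
  rintro _ ⟨i, rfl⟩
  refine (congrFun₂ map_commutator i i).trans ?_
  by_cases hi : i = 0
  · exact hi ▸ commutator_diag_eq_zero_of_ne fun j hj => h ⟨j, hj⟩
  · exact h ⟨i, hi⟩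

variable (h : ∀ j : RowIndex n, diagEntry f t j = 0)

/-- The homomorphism out of `R/I` determined by the images `f` of the parameters and `t` of the
remaining entries of the first row of `X`. -/
def coordRingLift : CoordRing n K →ₐ[K] S :=
  Ideal.Quotient.liftₐ _ (polyRingLift K f t) fun _ ha => diagIdeal_le_ker_polyRingLift h ha

@[simp]
theorem coordRingLift_paramBar (s : ParamIndex n) :
    coordRingLift (K := K) f t h (paramBar n K s) = f s :=
  (Ideal.Quotient.lift_mk _ _ _).trans (polyRingLift_param f t s)

@[simp]
theorem coordRingLift_rowBar (j : RowIndex n) :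
    coordRingLift (K := K) f t h (rowBar n K j) = t j :=
  (Ideal.Quotient.lift_mk _ _ _).trans <|
    (congrFun₂ (map_polyRingLift_matX f t) 0 j).trans (xMatrix_zero_row f t j)

end lift

theorem coordRing_algHom_ext {φ ψ : CoordRing n K →ₐ[K] S}
    (hparam : ∀ s, φ (paramBar n K s) = ψ (paramBar n K s))
    (hrow : ∀ j, φ (rowBar n K j) = ψ (rowBar n K j)) : φ = ψ := by
  let φ' : CoordRing n K →+* S := φ
  let ψ' : CoordRing n K →+* S := ψ
  have hf : φ' ∘ paramBar n K = ψ' ∘ paramBar n K := funext hparam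
  have ht : φ' ∘ rowBar n K = ψ' ∘ rowBar n K := funext hrow
  have hX : ((matX n K).map (Ideal.Quotient.mk _)).map φ' =
      ((matX n K).map (Ideal.Quotient.mk _)).map ψ' := by
    rw [map_mk_matX, map_xMatrix, map_xMatrix, hf, ht]
  have hY : ((matY n K).map (Ideal.Quotient.mk _)).map φ' =
      ((matY n K).map (Ideal.Quotient.mk _)).map ψ' := by
    rw [map_mk_matY, map_yMatrix, map_yMatrix, hf, ht]
  refine Ideal.Quotient.algHom_ext _ (MvPolynomial.algHom_ext ?_)
  rintro (⟨i, j⟩ | ⟨i, j⟩)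
  · exact congrFun₂ hX i j
  · exact congrFun₂ hY i j

section Presentation

theorem diagEntry_root (f : ParamIndex n → S) (j : RowIndex n) :
    diagEntry (algebraMap S (AdjoinRoots (rowPoly f)) ∘ f) (AdjoinRoots.root (rowPoly f)) j = 0 :=
  neg_eq_zero.mp <|
    (eval₂_rowPoly f (algebraMap S _) _ j).symm.trans (AdjoinRoots.eval₂_root (rowPoly f) j)

/-- The homomorphism from `R/I` giving the parameters the values `f` in `S` and sending the
remaining entries of the first row of `X` to the adjoined roots. -/
def specialize (f : ParamIndex n → S) : CoordRing n K →ₐ[K] AdjoinRoots (rowPoly f) :=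
  coordRingLift (algebraMap S _ ∘ f) (AdjoinRoots.root _) (diagEntry_root f)

@[simp]
theorem specialize_paramBar (f : ParamIndex n → S) (s : ParamIndex n) :
    specialize f (paramBar n K s) = algebraMap S _ (f s) :=
  coordRingLift_paramBar _ _ _ _

@[simp]
theorem specialize_rowBar (f : ParamIndex n → S) (j : RowIndex n) :
    specialize f (rowBar n K j) = AdjoinRoots.root _ j :=
  coordRingLift_rowBar _ _ _ _

theorem eval₂_rowPoly_rowBar {f : ParamIndex n → S} {i : S →ₐ[K] T} {ψ : CoordRing n K →ₐ[K] T}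
    (h : ∀ s, i (f s) = ψ (paramBar n K s)) (j : RowIndex n) :
    (rowPoly f j).eval₂ i (ψ (rowBar n K j)) = 0 := by
  have comp_eq : (i : S →+* T) ∘ f = (ψ : CoordRing n K →+* T) ∘ paramBar n K := funext h
  refine (eval₂_rowPoly f (i : S →+* T) ((ψ : CoordRing n K →+* T) ∘ rowBar n K) j).trans ?_
  rw [comp_eq, ← map_diagEntry, diagEntry_bar, map_zero, neg_zero]

/-- The homomorphism induced on `AdjoinRoots (rowPoly f)` by a homomorphism `ψ` from `R/I` whose
values at the parameters come from `f`. -/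
def descend {f : ParamIndex n → S} (i : S →ₐ[K] T) (ψ : CoordRing n K →ₐ[K] T)
    (h : ∀ s, i (f s) = ψ (paramBar n K s)) : AdjoinRoots (rowPoly f) →ₐ[K] T :=
  AdjoinRoots.liftAlgHom i (fun j => ψ (rowBar n K j)) (eval₂_rowPoly_rowBar h)

section descend

variable {f : ParamIndex n → S} (i : S →ₐ[K] T) (ψ : CoordRing n K →ₐ[K] T)
  (h : ∀ s, i (f s) = ψ (paramBar n K s))

@[simp]
theorem descend_algebraMap (a : S) : descend i ψ h (algebraMap S _ a) = i a :=
  AdjoinRoots.liftAlgHom_algebraMap _ _ _ _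

@[simp]
theorem descend_root (j : RowIndex n) : descend i ψ h (AdjoinRoots.root _ j) = ψ (rowBar n K j) :=
  AdjoinRoots.liftAlgHom_root _ _ _ _

theorem descend_comp_specialize : (descend i ψ h).comp (specialize f) = ψ :=
  coordRing_algHom_ext
    (fun s => by rw [AlgHom.comp_apply, specialize_paramBar, descend_algebraMap, h])
    (fun j => by rw [AlgHom.comp_apply, specialize_rowBar, descend_root])

end descend

variable (n K) in
/-- The variables of the polynomial ring over `K` with one variable for each parameter. -/
abbrev paramVar : ParamIndex n → MvPolynomial (ParamIndex n) K := MvPolynomial.X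

theorem specialize_aeval_paramBar (a : MvPolynomial (ParamIndex n) K) :
    specialize (paramVar n K) (MvPolynomial.aeval (paramBar n K) a) = algebraMap _ _ a := by
  suffices (specialize (paramVar n K)).comp (MvPolynomial.aeval (paramBar n K)) =
      IsScalarTower.toAlgHom K _ _ from DFunLike.congr_fun this a
  exact MvPolynomial.algHom_ext fun s => by simp

variable (n K) in
/-- The inverse of `specialize` at the variables of the polynomial ring in the parameters. -/
def coordRingInv : AdjoinRoots (rowPoly (paramVar n K)) →ₐ[K] CoordRing n K :=
  descend (MvPolynomial.aeval (paramBar n K)) (.id K _) (MvPolynomial.aeval_X _)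

theorem coordRingInv_algebraMap (a : MvPolynomial (ParamIndex n) K) :
    coordRingInv n K (algebraMap _ _ a) = MvPolynomial.aeval (paramBar n K) a :=
  descend_algebraMap ..

theorem coordRingInv_root (j : RowIndex n) :
    coordRingInv n K (AdjoinRoots.root _ j) = rowBar n K j :=
  descend_root ..

variable (n K) in
/-- The presentation of `R/I` over the polynomial ring in the parameters: it arises by adjoining,
for each `j ≥ 2`, one root `t_j` of a monic quadratic polynomial. -/
def coordRingEquiv : CoordRing n K ≃ₐ[K] AdjoinRoots (rowPoly (paramVar n K)) :=
  AlgEquiv.ofAlgHom (specialize (paramVar n K)) (coordRingInv n K)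
    (AdjoinRoots.algHom_ext
      (fun a => (congrArg _ (coordRingInv_algebraMap a)).trans (specialize_aeval_paramBar a))
      (fun j => (congrArg _ (coordRingInv_root j)).trans (specialize_rowBar _ j)))
    (descend_comp_specialize ..)

theorem coordRingEquiv_paramBar (s : ParamIndex n) :
    coordRingEquiv n K (paramBar n K s) = algebraMap _ _ (paramVar n K s) :=
  specialize_paramBar (paramVar n K) s

theorem specialize_zero_of_mem_span_paramBar (a : CoordRing n K)
    (ha : a ∈ Ideal.span (Set.range (paramBar n K))) :
    specialize (0 : ParamIndex n → K) a = 0 := by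
  suffices Ideal.span (Set.range (paramBar n K)) ≤
      RingHom.ker (specialize (n := n) (0 : ParamIndex n → K)) from this ha
  rw [Ideal.span_le]
  rintro _ ⟨s, rfl⟩
  exact (specialize_paramBar _ s).trans (map_zero _)

theorem ofId_zero_eq_mkₐ_paramBar (s : ParamIndex n) :
    Algebra.ofId K (ParamQuotient n K) ((0 : ParamIndex n → K) s) =
      Ideal.Quotient.mkₐ K _ (paramBar n K s) :=
  (map_zero _).trans <| Eq.symm <|
    Ideal.Quotient.eq_zero_iff_mem.mpr (Ideal.subset_span (Set.mem_range_self s))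

variable (n K) in
/-- The homomorphism induced by `specialize 0` on the quotient of `R/I` by the parameters. -/
def paramQuotientHom : ParamQuotient n K →ₐ[K] AdjoinRoots (rowPoly (0 : ParamIndex n → K)) :=
  Ideal.Quotient.liftₐ _ (specialize 0) specialize_zero_of_mem_span_paramBar

theorem paramQuotientHom_mk_rowBar (j : RowIndex n) :
    paramQuotientHom n K (Ideal.Quotient.mk _ (rowBar n K j)) = AdjoinRoots.root _ j :=
  specialize_rowBar _ j

variable (n K) in
/-- The inverse of `paramQuotientHom`. -/
def paramQuotientInv : AdjoinRoots (rowPoly (0 : ParamIndex n → K)) →ₐ[K] ParamQuotient n K :=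
  descend (T := ParamQuotient n K) (Algebra.ofId K _) (Ideal.Quotient.mkₐ K _)
    ofId_zero_eq_mkₐ_paramBar

theorem paramQuotientInv_root (j : RowIndex n) :
    paramQuotientInv n K (AdjoinRoots.root _ j) = Ideal.Quotient.mk _ (rowBar n K j) :=
  descend_root (T := ParamQuotient n K) _ _ ofId_zero_eq_mkₐ_paramBar j

variable (n K) in
/-- Setting the parameters to zero in the presentation of `R/I`. -/
def paramQuotientEquiv :
    ParamQuotient n K ≃ₐ[K] AdjoinRoots (rowPoly (0 : ParamIndex n → K)) :=
  AlgEquiv.ofAlgHom (paramQuotientHom n K) (paramQuotientInv n K)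
    (AdjoinRoots.algHom_ext (AlgHom.commutes _) fun j =>
      (congrArg _ (paramQuotientInv_root j)).trans (paramQuotientHom_mk_rowBar j))
    (Ideal.Quotient.algHom_ext _ <|
      descend_comp_specialize (T := ParamQuotient n K) _ _ ofId_zero_eq_mkₐ_paramBar)

theorem paramQuotientEquiv_mk_rowBar (j : RowIndex n) :
    paramQuotientEquiv n K (Ideal.Quotient.mk _ (rowBar n K j)) = AdjoinRoots.root _ j :=
  paramQuotientHom_mk_rowBar j

variable (n K) in
/-- Adjoining to `K` one root of `T ^ 2` for each `j ≥ 2` gives the ring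
`K[x_{12}, …, x_{1n}]/(x_{12}², …, x_{1n}²)`. -/
def squareZeroEquiv : AdjoinRoots (rowPoly (0 : ParamIndex n → K)) ≃ₐ[K] SquareZeroRing n K :=
  Ideal.quotientEquivAlgOfEq K <| by
    simp only [rowPoly_zero, Polynomial.aeval_X_pow]

theorem squareZeroEquiv_root (j : RowIndex n) :
    squareZeroEquiv n K (AdjoinRoots.root _ j) = Ideal.Quotient.mk _ (MvPolynomial.X j) :=
  rfl

end Presentation

section Parameters

variable {A B ι : Type*} [CommRing A] [CommRing B]

theorem isRegularFamily_X [Nontrivial A] :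
    IsRegularFamily (MvPolynomial ι A) (MvPolynomial.X : ι → MvPolynomial ι A) :=
  fun _ hl _ => isRegular_map_X hl

theorem IsRegularFamily.algebraMap_comp [Algebra A B] [Module.FaithfullyFlat A B] {f : ι → A}
    (hf : IsRegularFamily A f) : IsRegularFamily B (algebraMap A B ∘ f) := fun l hl hmem => by
  simpa only [List.map_map] using (hf l hl hmem).of_faithfullyFlat (S := B)

theorem IsRegularFamily.of_ringEquiv (e : A ≃+* B) {f : ι → A} {g : ι → B}
    (hfg : ∀ i, e (f i) = g i) (hg : IsRegularFamily B g) : IsRegularFamily A f :=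
  fun l hl hmem =>
    have smul_eq (i : ι) (a : A) : e (f i • a) = g i • e a := by
      rw [smul_eq_mul, map_mul, hfg, smul_eq_mul]
    (e.toAddEquiv.isRegular_congr <| List.forall₂_map_left_iff.mpr <|
      List.forall₂_map_right_iff.mpr <| List.forall₂_same.mpr fun i _ => smul_eq i).mpr
        (hg l hl hmem)

theorem isRegularFamily_paramBar : IsRegularFamily (CoordRing n K) (paramBar n K) :=
  have := AdjoinRoots.faithfullyFlat (monic_rowPoly (paramVar n K)) (natDegree_rowPoly_ne_zero _)
  .of_ringEquiv (coordRingEquiv n K).toRingEquiv coordRingEquiv_paramBar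
    isRegularFamily_X.algebraMap_comp

theorem paramBar_mem_grading (s : ParamIndex n) : paramBar n K s ∈ grading n K 1 := by
  refine ⟨param n K s, (MvPolynomial.mem_homogeneousSubmodule ..).mpr ?_, rfl⟩
  rcases s with _ | _ | _ | _
  · exact MvPolynomial.isHomogeneous_X K _
  · exact MvPolynomial.isHomogeneous_X K _
  · exact MvPolynomial.isHomogeneous_X K _
  · exact (MvPolynomial.isHomogeneous_X K _).sub (MvPolynomial.isHomogeneous_X K _)

theorem ringKrullDim_coordRing :
    ringKrullDim (CoordRing n K) = (Fintype.card (ParamIndex n) : WithBot ℕ∞) := by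
  rw [ringKrullDim_eq_of_ringEquiv (coordRingEquiv n K).toRingEquiv,
    AdjoinRoots.ringKrullDim_eq (monic_rowPoly _) (natDegree_rowPoly_ne_zero _),
    MvPolynomial.ringKrullDim_of_isNoetherianRing, ringKrullDim_eq_zero_of_field, zero_add,
    Nat.card_eq_fintype_card]

theorem ringKrullDim_paramQuotient : ringKrullDim (ParamQuotient n K) = 0 := by
  rw [ringKrullDim_eq_of_ringEquiv (paramQuotientEquiv n K).toRingEquiv,
    AdjoinRoots.ringKrullDim_eq (monic_rowPoly _) (natDegree_rowPoly_ne_zero _),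
    ringKrullDim_eq_zero_of_field]

theorem isHomogeneousSOP_paramBar : IsHomogeneousSOP (grading n K) (paramBar n K) where
  homogeneous s := ⟨1, one_pos, paramBar_mem_grading s⟩
  card_eq_dim := ringKrullDim_coordRing
  quotient_dim := ringKrullDim_paramQuotient

end Parameters

end CoordRing

end CommDiag

end

theorem mainTheorem7_general {K : Type*} [Field K] {n : ℕ} [NeZero n] :
    CommDiag.IsHomogeneousSOP (CommDiag.grading n K) (CommDiag.paramBar n K) ∧
    CommDiag.IsRegularFamily (CommDiag.CoordRing n K) (CommDiag.paramBar n K) ∧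
    ∃ e : CommDiag.ParamQuotient n K ≃ₐ[K] CommDiag.SquareZeroRing n K,
      ∀ j : {j : Fin n // j ≠ 0},
        e (Ideal.Quotient.mk _ (Ideal.Quotient.mk _ (CommDiag.matX n K 0 j.1))) =
          Ideal.Quotient.mk _ (MvPolynomial.X j) :=
  ⟨CommDiag.isHomogeneousSOP_paramBar, CommDiag.isRegularFamily_paramBar,
    (CommDiag.paramQuotientEquiv n K).trans (CommDiag.squareZeroEquiv n K), fun j =>
      (congrArg _ (CommDiag.paramQuotientEquiv_mk_rowBar j)).trans
        (CommDiag.squareZeroEquiv_root j)⟩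

theorem mainTheorem7 {K : Type*} [Field K] {n : ℕ} [NeZero n] (hn : 3 ≤ n) :
    CommDiag.IsHomogeneousSOP (CommDiag.grading n K) (CommDiag.paramBar n K) ∧
    CommDiag.IsRegularFamily (CommDiag.CoordRing n K) (CommDiag.paramBar n K) ∧
    ∃ e : CommDiag.ParamQuotient n K ≃ₐ[K] CommDiag.SquareZeroRing n K,
      ∀ j : {j : Fin n // j ≠ 0},
        e (Ideal.Quotient.mk _ (Ideal.Quotient.mk _ (CommDiag.matX n K 0 j.1))) =
          Ideal.Quotient.mk _ (MvPolynomial.X j) :=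
  mainTheorem7_general
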